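/- Let $G=(V,E)$ be a finite connected graph (loops and multiple edges allowed) with a reference orientation of each edge and a total order $<$ on $E$. For $e\in E$ write $e^{+}$, $e^{-}$ for its two orientations ($e^+$ agreeing with the reference orientation; these are distinct symbols even when $e$ is a loop), and $e^{\pm}=(u,v)$ if that orientation goes from $u$ to $v$. A *partial orientation* is a set $\mathcal O$ of edge orientations containing at most one of $e^+,e^-$ for each $e$; if it contains neither, $e$ is *neutral*. A *directed cycle* is a list $v_1,e_1^{\delta_1},\dots,v_k,e_k^{\delta_k}$ ($k\ge 1$, up to rotation) with the edges $e_i$ distinct and $e_i^{\delta_i}=(v_i,v_{i+1})$, indices mod $k$; a *directed cut* is a pair $(S,S^c)$ with $\emptyset\ne S\subsetneq V$, and its edge orientations are all those from $S$ to $S^c$. A directed cycle (cut) is a *potential cycle (cut)* of $\mathcal O$ if whenever it contains $e^{\delta}$ we have $e^{-\delta}\notin\mathcal O$. Call $\mathcal O$ *cycle neutral* (*cut neutral*) if the $<$-minimum edge of every potential cycle (cut) of $\mathcal O$ is neutral in $\mathcal O$. Put $a_{e^+}=a_{e^-}=(1/2)^i$ if $e$ is the $i$-th smallest edge ($i=1$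 for the smallest). The *bigraphical arrangement* consists of the hyperplanes $H_{e^{\pm}}=\{x_v-x_u=a_{e^{\pm}}\}$, for $e^{\pm}=(u,v)$ with $e$ not a loop, in $U=\{x\in\mathbb R^{V}:\sum_v x_v=0\}$. The *bicographical arrangement* consists of the sets $H_{e^{\pm}}=\{x_{e^{\pm}}=a_{e^{\pm}}\}$, $e\in E$, in $U^*=\{x\in\mathbb R^{E}:\sum x_{e^{\delta}}=0 \text{ for every } v\in V, \text{ summing over all } e^\delta \text{ from } \{v\} \text{ to } V\setminus\{v\}\}$, where $x_{e^+}=x_e$ and $x_{e^-}=-x_e$. A *region* is a connected component of the complement of the arrangement in $U$ (resp. $U^*$). To a region $R$ associate the partial orientation $\mathcal O_R$ in which $e^{\pm}\in\mathcal O_R$ iff $x_v-x_u>a_{e^{\pm}}$ on $R$, where $e^{\pm}=(u,v)$ (resp. $x_{e^{\pm}}>a_{e^{\pm}}$ on $R$), i.e. $R$ lies on the side of $H_{e^\pm}$ opposite from $H_{e^\mp}$, and $e$ is neutral iff $R$ lies between $H_{e^+}$ and $H_{e^-}$ (loops, resp. isthmuses, are always neutral). **Proposition.** (1) The map $R\mapsto\mathcal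 O_R$ is a bijection from the regions of the bigraphical arrangement onto the cycle neutral partial orientations of $G$. (2) The map $R\mapsto\mathcal O_R$ is a bijection from the regions of the bicographical arrangement onto the cut neutral partial orientations of $G$. -/

import Mathlib

/-- An oriented graph: a multigraph (loops and multiple edges allowed) with vertex set `V` and edge
set `E`, together with a reference orientation `ref e = (u, v)` of every edge `e = {u, v}`. The
underlying unoriented edge `e` is the multiset of the two entries of `ref e`. -/
structure OrientedGraph (V E : Type*) where
  ref : E → V × V

namespace OrientedGraph

variable {V E : Type*}

/-- An orientation of an edge: `(e, 1)` is `e⁺`, which agrees with the reference orientation, and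
`(e, -1)` is `e⁻`, which disagrees with it. These are different symbols even when `e` is a loop. -/
abbrev EdgeOrientation (E : Type*) := E × ℤˣ

/-- The reversal `e^δ ↦ e^{-δ}`. -/
def EdgeOrientation.rev (a : EdgeOrientation E) : EdgeOrientation E := (a.1, -a.2)

/-- The pair `(u, v)` with `e^δ = (u, v)`. -/
def arc (G : OrientedGraph V E) (a : EdgeOrientation E) : V × V :=
  if a.2 = 1 then G.ref a.1 else (G.ref a.1).swap

/-- The initial vertex `u` of `e^δ = (u, v)`. -/
def tail (G : OrientedGraph V E) (a : EdgeOrientation E) : V := (G.arc a).1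

/-- The terminal vertex `v` of `e^δ = (u, v)`. -/
def head (G : OrientedGraph V E) (a : EdgeOrientation E) : V := (G.arc a).2

def IsLoop (G : OrientedGraph V E) (e : E) : Prop := (G.ref e).1 = (G.ref e).2

/-- The underlying graph is connected (in particular it has a vertex). -/
def Connected (G : OrientedGraph V E) : Prop :=
  (SimpleGraph.fromRel fun u v => ∃ e, G.ref e = (u, v)).Connected

/-! ### Directed cycles and cuts -/

/-- A directed cycle `v₁, e₁^δ₁, …, v_k, e_k^δ_k`, `k ≥ 1`, up to rotation: the edges `e_i` are
distinct and `e_i^δ_i = (v_i, v_{i+1})`, with indices modulo `k`. The vertices are determined by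
`v_i = tail (e_i^δ_i)`, so only the cyclic list of edge orientations is recorded. -/
structure IsDirectedCycle (G : OrientedGraph V E) (c : Cycle (EdgeOrientation E)) : Prop where
  ne_nil : c ≠ Cycle.nil
  nodup_edges : (c.map Prod.fst).Nodup
  chain : c.Chain fun a b => G.head a = G.tail b

/-- The set `𝔼` of edge orientations of a directed cycle. -/
def cycleArcs (c : Cycle (EdgeOrientation E)) : Set (EdgeOrientation E) := {a | a ∈ c}

/-- A directed cut is a pair `(U, Uᶜ)` with `U` and `Uᶜ` nonempty. -/
def IsDirectedCut (U : Set V) : Prop := U.Nonempty ∧ Uᶜ.Nonempty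

/-- The set `𝔼(U, Uᶜ)` of edge orientations from `U` to `Uᶜ`. -/
def cutArcs (G : OrientedGraph V E) (U : Set V) : Set (EdgeOrientation E) :=
  {a | G.tail a ∈ U ∧ G.head a ∈ Uᶜ}

/-! ### Partial orientations -/

/-- A partial orientation: a set of edge orientations that, for each edge `e`, does not contain
both `e⁺` and `e⁻`. -/
def IsPartialOrientation (O : Set (EdgeOrientation E)) : Prop :=
  ∀ e : E, (e, 1) ∉ O ∨ (e, -1) ∉ O

/-- The edge `e` is neutral in `O`. -/
def Neutral (O : Set (EdgeOrientation E)) (e : E) : Prop := (e, 1) ∉ O ∧ (e, -1) ∉ O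

/-- A directed cycle or directed cut with set of edge orientations `C` is a potential cycle or
potential cut of `O`: if `e^δ ∈ C` then `e^{-δ} ∉ O`. -/
def IsPotential (O C : Set (EdgeOrientation E)) : Prop := ∀ a ∈ C, a.rev ∉ O

/-- The minimum edge in each potential cycle is neutral. -/
def CycleNeutral [LinearOrder E] (G : OrientedGraph V E) (O : Set (EdgeOrientation E)) : Prop :=
  ∀ c : Cycle (EdgeOrientation E), G.IsDirectedCycle c → IsPotential O (cycleArcs c) →
    ∀ e : E, IsLeast (Prod.fst '' cycleArcs c) e → Neutral O e

/-- The minimum edge in each potential cut is neutral. -/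
def CutNeutral [LinearOrder E] (G : OrientedGraph V E) (O : Set (EdgeOrientation E)) : Prop :=
  ∀ U : Set V, IsDirectedCut U → IsPotential O (G.cutArcs U) →
    ∀ e : E, IsLeast (Prod.fst '' G.cutArcs U) e → Neutral O e

/-! ### Regions of arrangements -/

/-- The regions of an arrangement `𝒜` in a space `X`: the connected components of the complement
of the union of the members of `𝒜`. -/
def regions {X : Type*} [TopologicalSpace X] (𝒜 : Set (Set X)) : Set (Set X) :=
  {R | ∃ x ∈ (⋃₀ 𝒜)ᶜ, R = connectedComponentIn (⋃₀ 𝒜)ᶜ x}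

/-- Given functions `ℓ (e^δ)` on `X` with `ℓ (e⁻) = - ℓ (e⁺)` and parameters `A (e^δ) > 0`, the
hyperplane `H_{e^δ}` is `ℓ (e^δ) = A (e^δ)`, and its open side opposite from `H_{e^{-δ}}` is
`ℓ (e^δ) > A (e^δ)`. The set of all `e^δ` such that `R` lies in this open side is `O_R`. -/
def sideOrientation {X : Type*} (ℓ : EdgeOrientation E → X → ℝ) (A : EdgeOrientation E → ℝ)
    (R : Set X) : Set (EdgeOrientation E) :=
  {a | R ⊆ {x | A a < ℓ a x}}

/-- `O_R` is a partial orientation, and the edges that it leaves neutral are exactly those for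
which `R` lies between the two hyperplanes `H_{e⁺}` and `H_{e⁻}`. -/
theorem sideOrientation_spec {X : Type*} [TopologicalSpace X] {ℓ : EdgeOrientation E → X → ℝ}
    {A : EdgeOrientation E → ℝ} {𝒜 : Set (Set X)} (hc : ∀ a, Continuous (ℓ a))
    (hneg : ∀ a x, ℓ a.rev x = -ℓ a x) (hpos : ∀ a, 0 < A a)
    (hne : ∀ a, ∀ x ∈ (⋃₀ 𝒜)ᶜ, ℓ a x ≠ A a) {R : Set X} (hR : R ∈ regions 𝒜) :
    IsPartialOrientation (sideOrientation ℓ A R) ∧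
      ∀ e, Neutral (sideOrientation ℓ A R) e ↔
        R ⊆ {x | ℓ (e, 1) x < A (e, 1) ∧ ℓ (e, -1) x < A (e, -1)} := by
  obtain ⟨p, hp, rfl⟩ := hR
  have hpR := mem_connectedComponentIn hp
  have hn : ∀ e x, ℓ (e, -1) x = -ℓ (e, 1) x := fun e x => hneg (e, 1) x
  have hside : ∀ a, a ∉ sideOrientation ℓ A (connectedComponentIn (⋃₀ 𝒜)ᶜ p) →
      ∀ x ∈ connectedComponentIn (⋃₀ 𝒜)ᶜ p, ℓ a x < A a := by
    intro a ha x hx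
    by_contra hcon
    apply ha
    intro y hy
    by_contra hy'
    obtain ⟨z, hz, hzA⟩ := (isPreconnected_connectedComponentIn).intermediate_value hy hx
      (hc a).continuousOn ⟨not_lt.mp hy', not_lt.mp hcon⟩
    exact hne a z (connectedComponentIn_subset _ _ hz) hzA
  refine ⟨fun e => ?_, fun e => ⟨fun h x hx => ⟨hside _ h.1 x hx, hside _ h.2 x hx⟩, fun h => ?_⟩⟩
  · by_contra! hcon
    have h1 : A (e, 1) < ℓ (e, 1) p := hcon.1 hpR
    have h2 : A (e, -1) < ℓ (e, -1) p := hcon.2 hpR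
    have := hn e p
    have := hpos (e, 1)
    have := hpos (e, -1)
    linarith
  · exact ⟨fun hh => lt_asymm (h hpR).1 (hh hpR), fun hh => lt_asymm (h hpR).2 (hh hpR)⟩

/-! ### The bigraphical arrangement -/

/-- The subspace of `ℝ^V` where the coordinates sum to `0`. -/
def sumZero (V : Type*) [Fintype V] : Submodule ℝ (V → ℝ) :=
  LinearMap.ker (∑ v : V, (LinearMap.proj v : (V → ℝ) →ₗ[ℝ] ℝ))

/-- `x_v - x_u` for `e^δ = (u, v)`. -/
def potentialDiff [Fintype V] (G : OrientedGraph V E) (a : EdgeOrientation E)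
    (x : sumZero V) : ℝ :=
  x.1 (G.head a) - x.1 (G.tail a)

/-- The bigraphical arrangement: for each `e^δ = (u, v)` with `e` not a loop, the hyperplane
`x_v - x_u = A (e^δ)`. -/
def bigraphicalArrangement [Fintype V] (G : OrientedGraph V E) (A : EdgeOrientation E → ℝ) :
    Set (Set (sumZero V)) :=
  {H | ∃ a : EdgeOrientation E, ¬ G.IsLoop a.1 ∧ H = {x | G.potentialDiff a x = A a}}

/-- The map `R ↦ O_R` for the bigraphical arrangement. -/
def bigraphicalOrientation [Fintype V] (G : OrientedGraph V E) (A : EdgeOrientation E → ℝ)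
    (R : Set (sumZero V)) : Set (EdgeOrientation E) :=
  sideOrientation G.potentialDiff A R

theorem bigraphicalOrientation_spec [Fintype V] (G : OrientedGraph V E)
    {A : EdgeOrientation E → ℝ} (hpos : ∀ a, 0 < A a) {R : Set (sumZero V)}
    (hR : R ∈ regions (G.bigraphicalArrangement A)) :
    IsPartialOrientation (G.bigraphicalOrientation A R) ∧
      ∀ e, Neutral (G.bigraphicalOrientation A R) e ↔
        R ⊆ {x | G.potentialDiff (e, 1) x < A (e, 1) ∧ G.potentialDiff (e, -1) x < A (e, -1)} := by
  refine sideOrientation_spec (fun a => ?_) ?_ hpos ?_ hR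
  · exact ((continuous_apply _).comp continuous_subtype_val).sub
      ((continuous_apply _).comp continuous_subtype_val)
  · rintro ⟨e, δ⟩ x
    rcases Int.units_eq_one_or δ with rfl | rfl <;>
      simp [potentialDiff, head, tail, arc, EdgeOrientation.rev]
  · rintro ⟨e, δ⟩ x hx h
    by_cases hl : G.IsLoop e
    · have h0 : G.potentialDiff (e, δ) x = 0 := by
        unfold IsLoop at hl
        rcases Int.units_eq_one_or δ with rfl | rfl <;>
          simp [potentialDiff, head, tail, arc, hl]
      exact (hpos (e, δ)).ne (h0.symm.trans h)
    · exact hx ⟨_, ⟨(e, δ), hl, rfl⟩, h⟩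

/-! ### The bicographical arrangement -/

/-- The linear form `x_{e^δ}` on `ℝ^E`, with `x_{e⁻} = - x_{e⁺}`. -/
def coordForm (a : EdgeOrientation E) : (E → ℝ) →ₗ[ℝ] ℝ :=
  ((a.2 : ℤ) : ℝ) • LinearMap.proj a.1

open Classical in
/-- The subspace of `ℝ^E` where, for each vertex `v`, the sum of `x_{e^δ}` over all `e^δ` from
`{v}` to its complement is `0`. -/
noncomputable def flowSpace [Fintype E] (G : OrientedGraph V E) : Submodule ℝ (E → ℝ) :=
  ⨅ v : V, LinearMap.ker (∑ a : EdgeOrientation E with a ∈ G.cutArcs {v}, coordForm a)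

/-- `x_{e^δ}` as a function on the subspace `flowSpace`. -/
def flowCoord [Fintype E] (G : OrientedGraph V E) (a : EdgeOrientation E) (x : G.flowSpace) : ℝ :=
  coordForm a x.1

/-- The bicographical arrangement: for each `e^δ`, the hyperplane `x_{e^δ} = A (e^δ)`. (If `e` is
an isthmus, then this set is empty when `A (e^δ) > 0`, and does not affect the regions.) -/
def bicographicalArrangement [Fintype E] (G : OrientedGraph V E) (A : EdgeOrientation E → ℝ) :
    Set (Set G.flowSpace) :=
  {H | ∃ a : EdgeOrientation E, H = {x | G.flowCoord a x = A a}}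

/-- The map `R ↦ O_R` for the bicographical arrangement. -/
def bicographicalOrientation [Fintype E] (G : OrientedGraph V E) (A : EdgeOrientation E → ℝ)
    (R : Set G.flowSpace) : Set (EdgeOrientation E) :=
  sideOrientation G.flowCoord A R

theorem bicographicalOrientation_spec [Fintype E] (G : OrientedGraph V E)
    {A : EdgeOrientation E → ℝ} (hpos : ∀ a, 0 < A a) {R : Set G.flowSpace}
    (hR : R ∈ regions (G.bicographicalArrangement A)) :
    IsPartialOrientation (G.bicographicalOrientation A R) ∧
      ∀ e, Neutral (G.bicographicalOrientation A R) e ↔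
        R ⊆ {x | G.flowCoord (e, 1) x < A (e, 1) ∧ G.flowCoord (e, -1) x < A (e, -1)} := by
  refine sideOrientation_spec (fun a => ?_) ?_ hpos ?_ hR
  · exact ((continuous_apply a.1).comp continuous_subtype_val).const_smul ((a.2 : ℤ) : ℝ)
  · rintro ⟨e, δ⟩ x
    simp [flowCoord, coordForm, EdgeOrientation.rev]
  · rintro a x hx h
    exact hx ⟨_, ⟨a, rfl⟩, h⟩

/-! ### Exponential parameters -/

/-- The exponential parameter list: `a_{e⁺} = a_{e⁻} = (1/2)^i` if `e` is the `i`-th smallest edge,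
where `i = #{f | f ≤ e}` (so `i = 1` for the smallest edge). -/
noncomputable def expParam [Fintype E] [LinearOrder E] (a : EdgeOrientation E) : ℝ :=
  (1 / 2 : ℝ) ^ (Finset.univ.filter fun f : E => f ≤ a.1).card

end OrientedGraph

namespace OrientedGraph

variable {V E : Type*}

/-! ### Edge orientations -/

/-! Both parts are one statement about a subspace `W` of `ℝ^E`: the coboundaries in part (1), the
flow space in part (2). The hyperplanes at `± expParam` cut `ℝ^E` into open boxes `cell O`, one for
each partial orientation. Regions correspond to the nonempty sets `W ∩ cell O`, which are convex and
hence connected. So the map is injective, and the question is which cells meet `W`.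

Coordinates along a directed cycle or cut sum to zero on `W`. Since the parameter of the minimum
edge exceeds the sum of the others, a potential circuit whose minimum edge is oriented along it
would have positive sum (`notMem_of_sum_eq_zero`), so neutrality is necessary.

Conversely, suppose that `cell O` misses `W`. Hahn-Banach gives `f` orthogonal to `W` and positive
on the cell, so its infimum there is nonnegative (`sum_posPart_mul_lowerBound_nonneg`). But `f` is a
positive combination of circuits conformal to it, all of them potential; each has negative infimum
because its neutral minimum edge dominates (`sum_posPart_mul_lowerBound_neg`). This contradiction is
`exists_mem_cell`.

What remains is to find a conformal circuit: a nonzero circulation can be followed until it closes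
up, and a nonconstant potential has a sublevel set that is a cut. -/

theorem coordForm_apply (a : EdgeOrientation E) (y : E → ℝ) :
    coordForm a y = ((a.2 : ℤ) : ℝ) * y a.1 := by
  simp [coordForm]

@[simp]
theorem coordForm_one (e : E) (y : E → ℝ) : coordForm (e, 1) y = y e := by
  simp [coordForm]

@[simp]
theorem coordForm_neg_one (e : E) (y : E → ℝ) : coordForm (e, -1) y = -y e := by
  simp [coordForm]

@[simp]
theorem coordForm_rev (a : EdgeOrientation E) (y : E → ℝ) :
    coordForm a.rev y = -coordForm a y := by
  simp [coordForm_apply, EdgeOrientation.rev]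

theorem continuous_coordForm (a : EdgeOrientation E) :
    Continuous (coordForm a : (E → ℝ) → ℝ) :=
  (continuous_apply a.1).const_smul ((a.2 : ℤ) : ℝ)

theorem EdgeOrientation.eq_or_eq_rev {a b : EdgeOrientation E} (h : a.1 = b.1) :
    a = b ∨ a = b.rev := by
  obtain ⟨e, δ⟩ := a
  obtain ⟨f, ε⟩ := b
  obtain rfl : e = f := h
  rcases Int.units_eq_one_or δ with rfl | rfl <;> rcases Int.units_eq_one_or ε with rfl | rfl <;>
    simp [EdgeOrientation.rev]

@[simp]
theorem EdgeOrientation.rev_rev (a : EdgeOrientation E) : a.rev.rev = a := by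
  simp [EdgeOrientation.rev]

theorem sum_edgeOrientation [Fintype E] (g : EdgeOrientation E → ℝ) :
    ∑ a, g a = ∑ e, (g (e, 1) + g (e, -1)) := by
  rw [Fintype.sum_prod_type]
  refine Finset.sum_congr rfl fun e _ => ?_
  rw [UnitsInt.univ, Finset.sum_pair (by decide)]

/-- On a set of edge orientations where `y` is positive, the underlying edges are distinct. -/
theorem injOn_fst_of_coordForm_pos {C : Set (EdgeOrientation E)} {y : E → ℝ}
    (h : ∀ a ∈ C, 0 < coordForm a y) : Set.InjOn Prod.fst C := by
  intro a ha b hb hab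
  rcases EdgeOrientation.eq_or_eq_rev hab with rfl | rfl
  · rfl
  · have h1 := h _ ha
    have h2 := h _ hb
    rw [coordForm_rev] at h1
    linarith

/-! ### Exponential parameters -/

section ExpParam

variable [Fintype E] [LinearOrder E]

theorem expParam_pos (a : EdgeOrientation E) : 0 < expParam a := by
  unfold expParam
  positivity

@[simp]
theorem expParam_rev (a : EdgeOrientation E) : expParam a.rev = expParam a := rfl

theorem sum_Ioc_half_pow_lt (i n : ℕ) :
    ∑ j ∈ Finset.Ioc i n, (1 / 2 : ℝ) ^ j < (1 / 2 : ℝ) ^ i := by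
  rcases le_total i n with h | h
  · have : ∑ j ∈ Finset.Ioc i n, (1 / 2 : ℝ) ^ j = (1 / 2 : ℝ) ^ i - (1 / 2 : ℝ) ^ n := by
      induction n, h using Nat.le_induction with
      | base => simp
      | succ n hn ih =>
        rw [← Finset.insert_Ioc_right_eq_Ioc_add_one (by omega), Finset.sum_insert (by simp), ih]
        ring
    rw [this]
    have : (0 : ℝ) < (1 / 2 : ℝ) ^ n := by positivity
    linarith
  · rw [Finset.Ioc_eq_empty (by omega), Finset.sum_empty]
    positivity

theorem strictMono_card_filter_le :
    StrictMono fun e : E => (Finset.univ.filter fun f : E => f ≤ e).card := by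
  intro a b hab
  refine Finset.card_lt_card ⟨fun f hf => ?_, fun h => ?_⟩
  · simp only [Finset.mem_filter, Finset.mem_univ, true_and] at hf ⊢
    exact hf.trans hab.le
  · have := h (show b ∈ _ by simp)
    simp only [Finset.mem_filter, Finset.mem_univ, true_and] at this
    exact absurd this (not_le.mpr hab)

/-- The parameter of the minimum edge exceeds the sum of the parameters of the other edges. -/
theorem sum_erase_expParam_lt {C : Finset (EdgeOrientation E)}
    (hC : Set.InjOn Prod.fst (C : Set (EdgeOrientation E))) {a : EdgeOrientation E} (ha : a ∈ C)
    (hmin : ∀ b ∈ C, a.1 ≤ b.1) : ∑ b ∈ C.erase a, expParam b < expParam a := by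
  set r : E → ℕ := fun e => (Finset.univ.filter fun f : E => f ≤ e).card with hr
  have hmono : StrictMono r := strictMono_card_filter_le
  have hinj : Set.InjOn (fun b : EdgeOrientation E => r b.1) (C.erase a) := fun b hb c hc h =>
    hC (Finset.mem_of_mem_erase hb) (Finset.mem_of_mem_erase hc) (hmono.injective h)
  calc ∑ b ∈ C.erase a, expParam b
      = ∑ j ∈ (C.erase a).image fun b => r b.1, (1 / 2 : ℝ) ^ j := by
        rw [Finset.sum_image hinj]
        rfl
    -- The other edges have distinct ranks, all above the rank of `a.1`.
    _ ≤ ∑ j ∈ Finset.Ioc (r a.1) (Fintype.card E), (1 / 2 : ℝ) ^ j := by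
        refine Finset.sum_le_sum_of_subset_of_nonneg ?_ fun _ _ _ => by positivity
        intro j hj
        obtain ⟨b, hb, rfl⟩ := Finset.mem_image.mp hj
        obtain ⟨hba, hbC⟩ := Finset.mem_erase.mp hb
        refine Finset.mem_Ioc.mpr ⟨hmono (lt_of_le_of_ne (hmin b hbC) fun h => hba ?_),
          Finset.card_le_univ _⟩
        exact (hC ha hbC h).symm
    _ < expParam a := sum_Ioc_half_pow_lt _ _

end ExpParam

/-! ### Cells of an arrangement -/

section Cell

variable [Fintype E] [LinearOrder E]

/-- The vectors whose position relative to the hyperplanes `y (e^δ) = a (e^δ)` is encoded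
by `O`. -/
def cell (O : Set (EdgeOrientation E)) : Set (E → ℝ) :=
  {y | ∀ a, (a ∈ O → expParam a < coordForm a y) ∧ (a ∉ O → coordForm a y < expParam a)}

theorem neg_expParam_lt_of_mem_cell {O : Set (EdgeOrientation E)} {y : E → ℝ} (hy : y ∈ cell O)
    {a : EdgeOrientation E} (ha : a.rev ∉ O) : -expParam a < coordForm a y := by
  have := (hy a.rev).2 ha
  rw [coordForm_rev, expParam_rev] at this
  linarith

theorem convex_cell (O : Set (EdgeOrientation E)) : Convex ℝ (cell O) := by
  have : cell O = ⋂ a, ({y | a ∈ O → expParam a < coordForm a y} ∩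
      {y | a ∉ O → coordForm a y < expParam a}) := by
    ext y
    simp [cell]
  rw [this]
  refine convex_iInter fun a => ?_
  by_cases ha : a ∈ O
  · simpa [ha] using convex_halfSpace_gt (coordForm a).isLinear (expParam a)
  · simpa [ha] using convex_halfSpace_lt (coordForm a).isLinear (expParam a)

theorem isOpen_cell (O : Set (EdgeOrientation E)) : IsOpen (cell O) := by
  have : cell O = ⋂ a, ({y | a ∈ O → expParam a < coordForm a y} ∩
      {y | a ∉ O → coordForm a y < expParam a}) := by
    ext y
    simp [cell]
  rw [this]
  refine isOpen_iInter_of_finite fun a => ?_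
  by_cases ha : a ∈ O
  · simpa [ha] using isOpen_lt continuous_const (continuous_coordForm a)
  · simpa [ha] using isOpen_lt (continuous_coordForm a) continuous_const

open Classical in
theorem cell_nonempty {O : Set (EdgeOrientation E)} (hO : IsPartialOrientation O) :
    (cell O).Nonempty := by
  -- Any value beyond the parameter would do on oriented edges; the factor 2 is arbitrary.
  refine ⟨fun e => if (e, 1) ∈ O then 2 * expParam (e, 1) else
    if (e, -1) ∈ O then -(2 * expParam (e, 1)) else 0, ?_⟩
  rintro ⟨e, δ⟩
  have hpos := expParam_pos (e, (1 : ℤˣ))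
  have heq : expParam (e, (-1 : ℤˣ)) = expParam (e, (1 : ℤˣ)) := rfl
  rcases Int.units_eq_one_or δ with rfl | rfl <;>
    by_cases h1 : (e, 1) ∈ O <;> by_cases h2 : (e, -1) ∈ O <;>
      simp [h1, h2, heq] <;> first | linarith | (have := hO e; tauto)

/-- If the coordinates over a set of edge orientations with distinct edges sum to zero and
whose reversals are not in `O`, then the orientation of the minimum edge is not in `O`. -/
theorem notMem_of_sum_eq_zero {O : Set (EdgeOrientation E)} {y : E → ℝ} (hy : y ∈ cell O)
    {C : Finset (EdgeOrientation E)} (hC : Set.InjOn Prod.fst (C : Set (EdgeOrientation E)))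
    (hsum : ∑ a ∈ C, coordForm a y = 0) (hpot : IsPotential O (C : Set (EdgeOrientation E)))
    {a : EdgeOrientation E} (ha : a ∈ C) (hmin : ∀ b ∈ C, a.1 ≤ b.1) : a ∉ O := by
  intro haO
  have h1 := (hy a).1 haO
  have h2 : ∑ b ∈ C.erase a, -expParam b ≤ ∑ b ∈ C.erase a, coordForm b y :=
    Finset.sum_le_sum fun b hb =>
      (neg_expParam_lt_of_mem_cell hy (hpot b (Finset.mem_of_mem_erase hb))).le
  rw [Finset.sum_neg_distrib] at h2
  have h3 := sum_erase_expParam_lt hC ha hmin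
  rw [← Finset.add_sum_erase C _ ha] at hsum
  linarith

end Cell

/-! ### Signed indicator vectors -/

section SignedIndicator

variable [DecidableEq E]

/-- The signed indicator vector of a set of edge orientations. -/
def signedIndicator (C : Finset (EdgeOrientation E)) : E → ℝ :=
  ∑ a ∈ C, Pi.single a.1 ((a.2 : ℤ) : ℝ)

theorem signedIndicator_apply (C : Finset (EdgeOrientation E)) (e : E) :
    signedIndicator C e = ∑ a ∈ C, if a.1 = e then ((a.2 : ℤ) : ℝ) else 0 := by
  simp [signedIndicator, Finset.sum_apply, Pi.single_apply, eq_comm]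

theorem coordForm_signedIndicator_of_mem {C : Finset (EdgeOrientation E)}
    (hC : Set.InjOn Prod.fst (C : Set (EdgeOrientation E))) {a : EdgeOrientation E} (ha : a ∈ C) :
    coordForm a (signedIndicator C) = 1 := by
  rw [coordForm_apply, signedIndicator_apply, Finset.sum_eq_single a]
  · rcases Int.units_eq_one_or a.2 with h | h <;> simp [h]
  · intro b hb hba
    exact if_neg fun h => hba (hC hb ha h)
  · exact fun h => absurd ha h

theorem signedIndicator_eq_zero {C : Finset (EdgeOrientation E)} {e : E}
    (he : ∀ a ∈ C, a.1 ≠ e) : signedIndicator C e = 0 := by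
  rw [signedIndicator_apply]
  exact Finset.sum_eq_zero fun a ha => if_neg (he a ha)

theorem signedIndicator_dotProduct [Fintype E] (C : Finset (EdgeOrientation E)) (y : E → ℝ) :
    signedIndicator C ⬝ᵥ y = ∑ a ∈ C, coordForm a y := by
  simp [signedIndicator, sum_dotProduct, coordForm_apply]

end SignedIndicator

/-- With nonnegative weights only, lower bounds on the coordinates give a lower bound on the
product. -/
theorem dotProduct_eq_sum_posPart [Fintype E] (f y : E → ℝ) :
    f ⬝ᵥ y = ∑ a, max (coordForm a f) 0 * coordForm a y := by
  rw [sum_edgeOrientation, dotProduct]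
  refine Finset.sum_congr rfl fun e _ => ?_
  simp only [coordForm_one, coordForm_neg_one]
  rcases le_total 0 (f e) with h | h
  · rw [max_eq_left h, max_eq_right (by linarith)]
    ring
  · rw [max_eq_right h, max_eq_left (by linarith)]
    ring

/-! ### Circuit systems -/

section CircuitSystem

variable [Fintype E]

open Classical in
/-- A family `𝒞` of sets of edge orientations is a circuit system of a subspace `W` of `ℝ^E` if its
members have distinct underlying edges, are orthogonal to `W`, and every nonzero vector orthogonal
to `W` is positive on some nonempty member of `𝒞`. -/
structure IsCircuitSystem (W : Submodule ℝ (E → ℝ)) (𝒞 : Set (Set (EdgeOrientation E))) :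
    Prop where
  injOn : ∀ C ∈ 𝒞, Set.InjOn Prod.fst C
  sum_eq_zero : ∀ C ∈ 𝒞, ∀ y ∈ W, ∑ a with a ∈ C, coordForm a y = 0
  exists_conformal : ∀ f : E → ℝ, f ≠ 0 → (∀ y ∈ W, f ⬝ᵥ y = 0) →
    ∃ C ∈ 𝒞, C.Nonempty ∧ ∀ a ∈ C, 0 < coordForm a f

/-- The minimum edge of each member of `𝒞` that is potential for `O` is neutral. -/
def MinNeutral [LinearOrder E] (𝒞 : Set (Set (EdgeOrientation E)))
    (O : Set (EdgeOrientation E)) : Prop :=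
  ∀ C ∈ 𝒞, IsPotential O C → ∀ e, IsLeast (Prod.fst '' C) e → Neutral O e

variable [LinearOrder E]

open Classical in
/-- The infimum of the coordinate `y (e^δ)` over the cell of `O`, provided that `e^{-δ} ∉ O`. -/
noncomputable def lowerBound (O : Set (EdgeOrientation E)) (a : EdgeOrientation E) : ℝ :=
  if a ∈ O then expParam a else -expParam a

theorem lowerBound_le (O : Set (EdgeOrientation E)) (a : EdgeOrientation E) :
    lowerBound O a ≤ expParam a := by
  have := expParam_pos a
  unfold lowerBound
  split_ifs <;> linarith

/-- The neutral minimum edge contributes minus its parameter, which outweighs all the other terms.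
-/
theorem sum_lowerBound_neg {O : Set (EdgeOrientation E)} {C : Finset (EdgeOrientation E)}
    (hC : Set.InjOn Prod.fst (C : Set (EdgeOrientation E))) (hne : C.Nonempty)
    (hmin : ∀ e, IsLeast (Prod.fst '' (C : Set (EdgeOrientation E))) e → Neutral O e) :
    ∑ a ∈ C, lowerBound O a < 0 := by
  obtain ⟨a, ha, hle⟩ := C.exists_min_image Prod.fst hne
  have hn : Neutral O a.1 := hmin a.1 ⟨⟨a, ha, rfl⟩, by rintro _ ⟨b, hb, rfl⟩; exact hle b hb⟩
  have haO : a ∉ O := by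
    obtain ⟨e, δ⟩ := a
    rcases Int.units_eq_one_or δ with rfl | rfl
    · exact hn.1
    · exact hn.2
  have h1 : ∑ b ∈ C.erase a, lowerBound O b ≤ ∑ b ∈ C.erase a, expParam b :=
    Finset.sum_le_sum fun b _ => lowerBound_le O b
  have h2 := sum_erase_expParam_lt hC ha hle
  have h3 : lowerBound O a = -expParam a := if_neg haO
  rw [← Finset.add_sum_erase C _ ha, h3]
  linarith

/-- A nonzero vector orthogonal to `W` which is positive only at edge orientations whose reversals
are not in `O` attains a negative infimum on the cell of `O`. -/
theorem sum_posPart_mul_lowerBound_neg {W : Submodule ℝ (E → ℝ)}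
    {𝒞 : Set (Set (EdgeOrientation E))} (h𝒞 : IsCircuitSystem W 𝒞)
    {O : Set (EdgeOrientation E)} (hO : MinNeutral 𝒞 O) (f : E → ℝ) (hf : f ≠ 0)
    (hW : ∀ y ∈ W, f ⬝ᵥ y = 0) (hpot : ∀ a, 0 < coordForm a f → a.rev ∉ O) :
    ∑ a, max (coordForm a f) 0 * lowerBound O a < 0 := by
  classical
  -- Induction on the size of the support: each step peels off one conformal circuit.
  induction hn : (Finset.univ.filter fun e => f e ≠ 0).card using Nat.strong_induction_on
    generalizing f with
  | _ n ih =>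
    obtain ⟨C₀, hC₀, hne₀, hpos₀⟩ := h𝒞.exists_conformal f hf hW
    obtain ⟨C, rfl⟩ : ∃ C : Finset (EdgeOrientation E), C₀ = C :=
      ⟨Finset.univ.filter (· ∈ C₀), by ext; simp⟩
    have hinj := h𝒞.injOn _ hC₀
    have hpos : ∀ a ∈ C, 0 < coordForm a f := hpos₀
    have hne : C.Nonempty := hne₀
    -- The least value on the circuit is the largest multiple that can be subtracted without
    -- reversing a sign; it kills the edge of `a₀`.
    obtain ⟨a₀, ha₀, hle⟩ := C.exists_min_image (fun a => coordForm a f) hne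
    set t := coordForm a₀ f with ht
    set f' : E → ℝ := f - t • signedIndicator C with hf'
    have hcoord : ∀ a, coordForm a f' = coordForm a f - t * coordForm a (signedIndicator C) :=
      fun a => by simp [hf']
    have hmem : ∀ a ∈ C, coordForm a f' = coordForm a f - t := fun a ha => by
      rw [hcoord, coordForm_signedIndicator_of_mem hinj ha, mul_one]
    have hnot : ∀ e, (∀ a ∈ C, a.1 ≠ e) → f' e = f e := fun e he => by
      simp [hf', signedIndicator_eq_zero he]
    -- No signs cancel in the subtraction, so positive parts add.
    have hmax : ∀ a, max (coordForm a f) 0 =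
        (if a ∈ C then t else 0) + max (coordForm a f') 0 := by
      intro a
      by_cases ha : a ∈ C
      · rw [if_pos ha, hmem a ha, max_eq_left (hpos a ha).le,
          max_eq_left (sub_nonneg.mpr (hle a ha))]
        ring
      · rw [if_neg ha, zero_add]
        by_cases hr : a.rev ∈ C
        · have h1 := hmem _ hr
          have h2 := hpos _ hr
          have h3 := hle _ hr
          simp only [coordForm_rev] at h1 h2 h3
          rw [max_eq_right (by linarith), max_eq_right (by linarith)]
        · have : f' a.1 = f a.1 := hnot _ fun b hb hba => by
            rcases EdgeOrientation.eq_or_eq_rev hba with rfl | rfl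
            · exact ha hb
            · exact hr hb
          rw [coordForm_apply, coordForm_apply, this]
    have htpos : 0 < t := hpos a₀ ha₀
    have hsum : ∑ a, max (coordForm a f) 0 * lowerBound O a =
        t * ∑ a ∈ C, lowerBound O a + ∑ a, max (coordForm a f') 0 * lowerBound O a := by
      simp only [hmax, add_mul, Finset.sum_add_distrib, ite_mul, zero_mul]
      rw [Finset.sum_ite_mem, Finset.univ_inter, Finset.mul_sum]
    have hCneg : ∑ a ∈ C, lowerBound O a < 0 :=
      sum_lowerBound_neg hinj hne (hO _ hC₀ fun a ha => hpot a (hpos a ha))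
    have hle' : ∑ a, max (coordForm a f') 0 * lowerBound O a ≤ 0 := by
      by_cases hf0 : f' = 0
      · simp [hf0]
      · refine (ih _ ?_ f' hf0 ?_ ?_ rfl).le
        · rw [← hn]
          refine Finset.card_lt_card (Finset.ssubset_iff_of_subset ?_ |>.mpr ⟨a₀.1, ?_, ?_⟩)
          · intro e he
            simp only [Finset.mem_filter, Finset.mem_univ, true_and] at he ⊢
            intro hfe
            refine he ((hnot e fun a ha hae => ?_).trans hfe)
            have := hpos a ha
            rw [coordForm_apply, hae, hfe, mul_zero] at this
            exact this.false
          · simp only [Finset.mem_filter, Finset.mem_univ, true_and]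
            intro h
            rw [ht, coordForm_apply, h, mul_zero] at htpos
            exact htpos.false
          · have := hmem a₀ ha₀
            rw [← ht, sub_self, coordForm_apply] at this
            simpa using this
        · intro y hy
          have := h𝒞.sum_eq_zero _ hC₀ y hy
          simp only [Finset.mem_coe, Finset.filter_univ_mem] at this
          rw [hf', sub_dotProduct, smul_dotProduct, hW y hy, signedIndicator_dotProduct, this,
            smul_zero, sub_zero]
        · intro a ha
          refine hpot a ?_
          have h1 := hmax a
          rw [max_eq_left ha.le] at h1
          by_contra hcon
          rw [max_eq_right (not_lt.mp hcon)] at h1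
          split_ifs at h1 <;> linarith
    rw [hsum]
    have := mul_neg_of_pos_of_neg htpos hCneg
    linarith

/-- If `f` is positive on the cell of `O`, then it is positive only at edge orientations whose
reversals are not in `O`. -/
theorem rev_notMem_of_pos_on_cell {O : Set (EdgeOrientation E)} (hO : IsPartialOrientation O)
    {f : E → ℝ} (hf : ∀ y ∈ cell O, 0 < f ⬝ᵥ y) {a : EdgeOrientation E}
    (ha : 0 < coordForm a f) : a.rev ∉ O := by
  classical
  intro hr
  obtain ⟨y, hy⟩ := cell_nonempty hO
  have hfy := hf y hy
  -- The cell is unbounded in the direction of `a.rev`; moving by `t` that way brings `f` down to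
  -- exactly zero.
  set t := f ⬝ᵥ y / coordForm a f with ht
  have ht0 : 0 < t := div_pos hfy ha
  have hmem : y + t • signedIndicator {a.rev} ∈ cell O := by
    have hinj : Set.InjOn Prod.fst (({a.rev} : Finset (EdgeOrientation E)) :
        Set (EdgeOrientation E)) := by simp
    have h1 := coordForm_signedIndicator_of_mem hinj (Finset.mem_singleton_self a.rev)
    have haO : a ∉ O := by
      intro h
      have := (hy _).1 h
      have := (hy _).1 hr
      have := expParam_pos a
      simp only [coordForm_rev, expParam_rev] at *
      linarith
    intro b
    rw [map_add, map_smul, smul_eq_mul]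
    by_cases hb : b.1 = a.rev.1
    · rcases EdgeOrientation.eq_or_eq_rev hb with rfl | rfl
      · refine ⟨fun h => ?_, fun h => absurd hr h⟩
        have := (hy _).1 h
        rw [h1]
        linarith
      · rw [EdgeOrientation.rev_rev]
        refine ⟨fun h => absurd h haO, fun h => ?_⟩
        have := (hy _).2 h
        rw [coordForm_rev] at h1
        nlinarith
    · have : coordForm b (signedIndicator {a.rev}) = 0 := by
        rw [coordForm_apply, signedIndicator_eq_zero, mul_zero]
        simpa using fun h => hb h.symm
      rw [this, mul_zero, add_zero]
      exact hy b
  have := hf _ hmem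
  rw [dotProduct_add, dotProduct_smul, dotProduct_comm f (signedIndicator _),
    signedIndicator_dotProduct, Finset.sum_singleton, coordForm_rev, smul_eq_mul, ht, mul_neg,
    div_mul_cancel₀ _ ha.ne'] at this
  linarith

/-- The infimum of `f` on the cell of `O` is at least zero if `f` is positive there. -/
theorem sum_posPart_mul_lowerBound_nonneg {O : Set (EdgeOrientation E)}
    (hO : IsPartialOrientation O) {f : E → ℝ} (hf : ∀ y ∈ cell O, 0 < f ⬝ᵥ y) :
    0 ≤ ∑ a, max (coordForm a f) 0 * lowerBound O a := by
  have hrev := fun a => rev_notMem_of_pos_on_cell hO hf (a := a)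
  obtain ⟨y₀, hy₀⟩ := cell_nonempty hO
  -- A point of the closed cell at which `f` takes its infimum; where `f` vanishes, the coordinate
  -- of `y₀` keeps it in the closure.
  set z : E → ℝ := fun e => if 0 < f e then lowerBound O (e, 1) else
    if f e < 0 then -lowerBound O (e, -1) else y₀ e with hz
  have hzpos : ∀ a, 0 < coordForm a f → coordForm a z = lowerBound O a := by
    rintro ⟨e, δ⟩ ha
    rcases Int.units_eq_one_or δ with rfl | rfl
    · rw [coordForm_one] at ha
      simp [hz, ha]
    · rw [coordForm_neg_one] at ha
      have h1 : f e < 0 := by linarith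
      simp [hz, h1, h1.not_gt]
  have hzzero : ∀ a, coordForm a f = 0 → coordForm a z = coordForm a y₀ := by
    rintro ⟨e, δ⟩ ha
    have h0 : f e = 0 := by
      rcases Int.units_eq_one_or δ with rfl | rfl <;> simpa using ha
    rw [coordForm_apply, coordForm_apply]
    simp [hz, h0]
  have hweak' : ∀ a, 0 < coordForm a f → (a ∈ O → expParam a ≤ coordForm a z) ∧
      (a ∉ O → coordForm a z ≤ expParam a) := by
    intro a ha
    rw [hzpos a ha]
    exact ⟨fun h => (if_pos h).ge, fun _ => lowerBound_le O a⟩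
  have hweak : ∀ a, (a ∈ O → expParam a ≤ coordForm a z) ∧
      (a ∉ O → coordForm a z ≤ expParam a) := by
    intro a
    rcases lt_trichotomy (coordForm a f) 0 with h | h | h
    · have hr : 0 < coordForm a.rev f := by
        rw [coordForm_rev]
        linarith
      have haO : a ∉ O := by simpa using hrev _ hr
      refine ⟨fun h' => absurd h' haO, fun _ => ?_⟩
      have h1 := hzpos _ hr
      have h2 : -expParam a ≤ lowerBound O a.rev := by
        have := expParam_pos a
        unfold lowerBound
        rw [expParam_rev]
        split_ifs <;> linarith
      rw [coordForm_rev] at h1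
      linarith
    · rw [hzzero a h]
      exact ⟨fun h' => ((hy₀ a).1 h').le, fun h' => ((hy₀ a).2 h').le⟩
    · exact hweak' a h
  have hval : f ⬝ᵥ z = ∑ a, max (coordForm a f) 0 * lowerBound O a := by
    rw [dotProduct_eq_sum_posPart]
    refine Finset.sum_congr rfl fun a _ => ?_
    rcases le_or_gt (coordForm a f) 0 with h | h
    · rw [max_eq_right h, zero_mul, zero_mul]
    · rw [hzpos a h]
  rw [← hval]
  by_contra! hneg
  have h0 := hf y₀ hy₀
  -- The zero of `f` on the segment from `z` to `y₀`. As `s > 0`, the strict inequalities at `y₀`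
  -- put this point in the open cell.
  set s := -(f ⬝ᵥ z) / (f ⬝ᵥ y₀ - f ⬝ᵥ z) with hs
  have hden : 0 < f ⬝ᵥ y₀ - f ⬝ᵥ z := by linarith
  have hs0 : 0 < s := div_pos (by linarith) hden
  have hs1 : s < 1 := (div_lt_one hden).mpr (by linarith)
  have hmem : (1 - s) • z + s • y₀ ∈ cell O := by
    intro a
    simp only [map_add, map_smul, smul_eq_mul]
    refine ⟨fun h => ?_, fun h => ?_⟩
    · have h1 := (hweak a).1 h
      have h2 := (hy₀ a).1 h
      nlinarith
    · have h1 := (hweak a).2 h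
      have h2 := (hy₀ a).2 h
      nlinarith
  have := hf _ hmem
  rw [dotProduct_add, dotProduct_smul, dotProduct_smul, smul_eq_mul, smul_eq_mul] at this
  have h3 : s * (f ⬝ᵥ y₀ - f ⬝ᵥ z) = -(f ⬝ᵥ z) := div_mul_cancel₀ _ hden.ne'
  linarith

/-- The cell of `O` meets `W` if the minimum edges of potential circuits are neutral. -/
theorem exists_mem_cell {W : Submodule ℝ (E → ℝ)} {𝒞 : Set (Set (EdgeOrientation E))}
    (h𝒞 : IsCircuitSystem W 𝒞) {O : Set (EdgeOrientation E)} (hO : IsPartialOrientation O)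
    (hmin : MinNeutral 𝒞 O) : ∃ y ∈ W, y ∈ cell O := by
  classical
  by_contra! hcon
  obtain ⟨φ, u, hlt, hge⟩ := geometric_hahn_banach_open (convex_cell O) (isOpen_cell O) W.convex
    (Set.disjoint_left.mpr fun y hy hyW => hcon y hyW hy)
  have hu : u ≤ 0 := by simpa using hge 0 W.zero_mem
  have hφ : ∀ y ∈ W, φ y = 0 := by
    intro y hy
    by_contra hne
    -- A functional bounded below on a subspace vanishes there: this multiple of `y` would have
    -- value `u - 1`.
    have := hge (((u - 1) / φ y) • y) (W.smul_mem _ hy)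
    rw [map_smul, smul_eq_mul, div_mul_cancel₀ _ hne] at this
    linarith
  set f : E → ℝ := fun e => -φ (Pi.single e 1) with hf
  have hdot : ∀ y, f ⬝ᵥ y = -φ y := by
    intro y
    conv_rhs => rw [pi_eq_sum_univ' y]
    simp [hf, dotProduct, map_sum, mul_comm]
  have hpos : ∀ y ∈ cell O, 0 < f ⬝ᵥ y := fun y hy => by
    rw [hdot]
    linarith [hlt y hy]
  have hf0 : f ≠ 0 := by
    intro h
    obtain ⟨y, hy⟩ := cell_nonempty hO
    simpa [h] using hpos y hy
  exact (sum_posPart_mul_lowerBound_nonneg hO hpos).not_gt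
    (sum_posPart_mul_lowerBound_neg h𝒞 hmin f hf0 (fun y hy => by rw [hdot, hφ y hy, neg_zero])
      fun a ha => rev_notMem_of_pos_on_cell hO hpos ha)

end CircuitSystem

/-! ### Regions and neutral orientations -/

section Regions

variable [Fintype E] [LinearOrder E] {X : Type*} [AddCommGroup X] [Module ℝ X]
  {ℓ : EdgeOrientation E → X → ℝ}
  {L : X →ₗ[ℝ] E → ℝ} {𝒜 : Set (Set X)}

theorem mem_cell_of_mem_compl (hℓ : ∀ a x, ℓ a x = coordForm a (L x))
    (h𝒜 : ∀ x, x ∈ (⋃₀ 𝒜)ᶜ ↔ ∀ a, ℓ a x ≠ expParam a) {x : X} (hx : x ∈ (⋃₀ 𝒜)ᶜ) :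
    L x ∈ cell {a | expParam a < ℓ a x} := by
  intro a
  rw [← hℓ]
  exact ⟨id, fun h => lt_of_le_of_ne (not_lt.mp h) ((h𝒜 x).mp hx a)⟩

theorem mem_compl_of_mem_cell (hℓ : ∀ a x, ℓ a x = coordForm a (L x))
    (h𝒜 : ∀ x, x ∈ (⋃₀ 𝒜)ᶜ ↔ ∀ a, ℓ a x ≠ expParam a) {O : Set (EdgeOrientation E)} {x : X}
    (hx : L x ∈ cell O) : x ∈ (⋃₀ 𝒜)ᶜ := by
  refine (h𝒜 x).mpr fun a => ?_
  rw [hℓ]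
  by_cases ha : a ∈ O
  · exact ((hx a).1 ha).ne'
  · exact ((hx a).2 ha).ne

theorem setOf_expParam_lt_eq_of_mem_cell (hℓ : ∀ a x, ℓ a x = coordForm a (L x))
    {O : Set (EdgeOrientation E)} {x : X} (hx : L x ∈ cell O) :
    {a | expParam a < ℓ a x} = O := by
  ext a
  rw [Set.mem_ofPred_eq, hℓ]
  exact ⟨fun h => by_contra fun ha => lt_asymm h ((hx a).2 ha), (hx a).1⟩

variable [TopologicalSpace X]

/-- By the intermediate value theorem no coordinate crosses its parameter within a component, so one
point determines the orientation. -/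
theorem sideOrientation_connectedComponentIn (hL : Continuous L)
    (hℓ : ∀ a x, ℓ a x = coordForm a (L x))
    (h𝒜 : ∀ x, x ∈ (⋃₀ 𝒜)ᶜ ↔ ∀ a, ℓ a x ≠ expParam a) {x : X} (hx : x ∈ (⋃₀ 𝒜)ᶜ) :
    sideOrientation ℓ expParam (connectedComponentIn (⋃₀ 𝒜)ᶜ x) = {a | expParam a < ℓ a x} := by
  have hc : ∀ a, Continuous (ℓ a) := fun a => by
    rw [funext (hℓ a)]
    exact (continuous_coordForm a).comp hL
  ext a
  refine ⟨fun h => h (mem_connectedComponentIn hx), fun h y hy => ?_⟩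
  by_contra hy'
  obtain ⟨z, hz, hza⟩ := isPreconnected_connectedComponentIn.intermediate_value hy
    (mem_connectedComponentIn hx) (hc a).continuousOn ⟨not_lt.mp hy', le_of_lt h⟩
  exact (h𝒜 z).mp (connectedComponentIn_subset _ _ hz) a hza

/-- The regions of an arrangement with exponential parameters correspond to the partial
orientations in which the minimum edges of potential circuits are neutral. -/
theorem bijOn_sideOrientation [IsTopologicalAddGroup X] [ContinuousSMul ℝ X] (hL : Continuous L)
    (hℓ : ∀ a x, ℓ a x = coordForm a (L x))
    (h𝒜 : ∀ x, x ∈ (⋃₀ 𝒜)ᶜ ↔ ∀ a, ℓ a x ≠ expParam a) {𝒞 : Set (Set (EdgeOrientation E))}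
    (h𝒞 : IsCircuitSystem (LinearMap.range L) 𝒞) :
    Set.BijOn (sideOrientation ℓ expParam) (regions 𝒜)
      {O | IsPartialOrientation O ∧ MinNeutral 𝒞 O} := by
  classical
  refine ⟨?_, ?_, ?_⟩
  · rintro _ ⟨x, hx, rfl⟩
    rw [sideOrientation_connectedComponentIn hL hℓ h𝒜 hx]
    have hcell := mem_cell_of_mem_compl hℓ h𝒜 hx
    refine ⟨fun e => ?_, fun C hC hpot e he => ?_⟩
    · by_contra! h
      have h1 := (hcell _).1 h.1
      have h2 := (hcell _).1 h.2
      have := expParam_pos (e, (1 : ℤˣ))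
      have := expParam_pos (e, (-1 : ℤˣ))
      rw [coordForm_one] at h1
      rw [coordForm_neg_one] at h2
      linarith
    · obtain ⟨C, rfl⟩ : ∃ D : Finset (EdgeOrientation E), C = D :=
        ⟨Finset.univ.filter (· ∈ C), by ext; simp⟩
      have hsum := h𝒞.sum_eq_zero _ hC _ (LinearMap.mem_range_self L x)
      simp only [Finset.mem_coe, Finset.filter_univ_mem] at hsum
      obtain ⟨⟨a, ha, rfl⟩, hle⟩ := he
      have h1 := notMem_of_sum_eq_zero hcell (h𝒞.injOn _ hC) hsum hpot ha
        fun b hb => hle ⟨b, hb, rfl⟩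
      have h2 := hpot a ha
      obtain ⟨e, δ⟩ := a
      rcases Int.units_eq_one_or δ with rfl | rfl
      · exact ⟨h1, h2⟩
      · exact ⟨by simpa [EdgeOrientation.rev] using h2, h1⟩
  · rintro _ ⟨x, hx, rfl⟩ _ ⟨y, hy, rfl⟩ hxy
    rw [sideOrientation_connectedComponentIn hL hℓ h𝒜 hx,
      sideOrientation_connectedComponentIn hL hℓ h𝒜 hy] at hxy
    have hxc := mem_cell_of_mem_compl hℓ h𝒜 hx
    have hyc := mem_cell_of_mem_compl hℓ h𝒜 hy
    rw [← hxy] at hyc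
    -- Both base points lie in this convex set, which avoids the arrangement, so they share a
    -- component.
    have hconv : Convex ℝ (L ⁻¹' cell {a | expParam a < ℓ a x}) :=
      (convex_cell _).linear_preimage L
    exact connectedComponentIn_eq (hconv.isPreconnected.subset_connectedComponentIn hxc
      (fun z hz => mem_compl_of_mem_cell hℓ h𝒜 hz) hyc)
  · rintro O ⟨hO, hmin⟩
    obtain ⟨_, ⟨x, rfl⟩, hx⟩ := exists_mem_cell h𝒞 hO hmin
    have hxS := mem_compl_of_mem_cell hℓ h𝒜 hx
    exact ⟨_, ⟨x, hxS, rfl⟩, by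
      rw [sideOrientation_connectedComponentIn hL hℓ h𝒜 hxS,
        setOf_expParam_lt_eq_of_mem_cell hℓ hx]⟩

end Regions

/-! ### Incidences -/

section Incidence

variable (G : OrientedGraph V E)

@[simp]
theorem tail_rev (a : EdgeOrientation E) : G.tail a.rev = G.head a := by
  obtain ⟨e, δ⟩ := a
  rcases Int.units_eq_one_or δ with rfl | rfl <;> simp [tail, head, arc, EdgeOrientation.rev]

@[simp]
theorem head_rev (a : EdgeOrientation E) : G.head a.rev = G.tail a := by
  rw [← tail_rev, EdgeOrientation.rev_rev]

theorem tail_neg_one (e : E) : G.tail (e, -1) = G.head (e, 1) := G.tail_rev (e, 1)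

theorem head_neg_one (e : E) : G.head (e, -1) = G.tail (e, 1) := G.head_rev (e, 1)

/-- The coboundary map, which takes a potential to its differences along edges. -/
def coboundary : (V → ℝ) →ₗ[ℝ] E → ℝ where
  toFun p e := p (G.head (e, 1)) - p (G.tail (e, 1))
  map_add' p q := by
    ext e
    simp only [Pi.add_apply]
    ring
  map_smul' c p := by
    ext e
    simp only [Pi.smul_apply, smul_eq_mul, RingHom.id_apply]
    ring

theorem coboundary_apply (p : V → ℝ) (e : E) :
    G.coboundary p e = p (G.head (e, 1)) - p (G.tail (e, 1)) := rfl

theorem coordForm_coboundary (a : EdgeOrientation E) (p : V → ℝ) :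
    coordForm a (G.coboundary p) = p (G.head a) - p (G.tail a) := by
  obtain ⟨e, δ⟩ := a
  rcases Int.units_eq_one_or δ with rfl | rfl
  · rw [coordForm_one, coboundary_apply]
  · rw [coordForm_neg_one, coboundary_apply, head_neg_one, tail_neg_one, neg_sub]

/-- Summation by parts: when `p` is the indicator of a vertex, the left side is the net outflow
there, with loops cancelling. -/
theorem sum_tail_mul_coordForm [Fintype E] (p : V → ℝ) (y : E → ℝ) :
    ∑ a, p (G.tail a) * coordForm a y = -(G.coboundary p ⬝ᵥ y) := by
  rw [sum_edgeOrientation, dotProduct, ← Finset.sum_neg_distrib]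
  refine Finset.sum_congr rfl fun e _ => ?_
  rw [coordForm_one, coordForm_neg_one, tail_neg_one, coboundary_apply]
  ring

end Incidence

/-! ### Cycles -/

section Cycles

variable (G : OrientedGraph V E)

/-- The sum telescopes. Keeping the last arc `b` separate lets the induction run; a cycle is the
case `b = a`. -/
theorem sum_map_sub_of_isChain (p : V → ℝ) (l : List (EdgeOrientation E)) (a b : EdgeOrientation E)
    (h : List.IsChain (fun a b => G.head a = G.tail b) (a :: (l ++ [b]))) :
    ((a :: l).map fun a => p (G.head a) - p (G.tail a)).sum = p (G.tail b) - p (G.tail a) := by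
  induction l generalizing a with
  | nil =>
    have : G.head a = G.tail b := by simpa using h
    simp [this]
  | cons c l ih =>
    rw [List.cons_append, List.isChain_cons_cons] at h
    rw [List.map_cons, List.sum_cons, ih c h.2, h.1]
    ring

variable {G}

theorem IsDirectedCycle.injOn {c : Cycle (EdgeOrientation E)} (hc : G.IsDirectedCycle c) :
    Set.InjOn Prod.fst (cycleArcs c) := by
  have h := hc.nodup_edges
  induction c using Quotient.inductionOn' with
  | h l => exact fun a ha b hb hab => List.inj_on_of_nodup_map h ha hb hab

open Classical in
theorem IsDirectedCycle.sum_eq_zero [Fintype E] {c : Cycle (EdgeOrientation E)}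
    (hc : G.IsDirectedCycle c) (p : V → ℝ) :
    ∑ a with a ∈ cycleArcs c, (p (G.head a) - p (G.tail a)) = 0 := by
  obtain ⟨hnil, hnodup, hchain⟩ := hc
  induction c using Quotient.inductionOn' with
  | h l =>
    have hl : l.Nodup := List.Nodup.of_map _ hnodup
    have hset : (Finset.univ.filter fun a => a ∈ cycleArcs (l : Cycle (EdgeOrientation E))) =
        l.toFinset := by
      ext a
      simp [cycleArcs]
    refine Eq.trans (Finset.sum_congr hset fun _ _ => rfl) ?_
    rw [List.sum_toFinset _ hl]
    cases l with
    | nil => exact absurd rfl hnil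
    | cons a l => rw [G.sum_map_sub_of_isChain p l a a hchain, sub_self]

theorem exists_mem_periodicPts {α : Type*} [Finite α] [Nonempty α] (f : α → α) :
    ∃ x, x ∈ Function.periodicPts f := by
  obtain ⟨x⟩ := ‹Nonempty α›
  obtain ⟨m, n, hmn, h⟩ := Finite.exists_ne_map_eq_of_infinite fun n : ℕ => f^[n] x
  wlog hlt : m < n generalizing m n
  · exact this n m hmn.symm h.symm (lt_of_le_of_ne (not_lt.mp hlt) hmn.symm)
  refine ⟨f^[m] x, Function.mk_mem_periodicPts (Nat.sub_pos_of_lt hlt) ?_⟩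
  rw [Function.IsPeriodicPt, Function.IsFixedPt, ← Function.iterate_add_apply,
    Nat.sub_add_cancel hlt.le]
  exact h.symm

/-- A nonzero circulation is positive on a directed cycle. -/
theorem exists_isDirectedCycle_pos [Finite E] {f : E → ℝ} (hf : f ≠ 0)
    (hnext : ∀ a : EdgeOrientation E, 0 < coordForm a f →
      ∃ b, 0 < coordForm b f ∧ G.head a = G.tail b) :
    ∃ c, G.IsDirectedCycle c ∧ ∀ a ∈ cycleArcs c, 0 < coordForm a f := by
  choose next hpos hadj using hnext
  let α := {a : EdgeOrientation E // 0 < coordForm a f}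
  have : Nonempty α := by
    obtain ⟨e, he⟩ := Function.ne_iff.mp hf
    rcases lt_or_gt_of_ne he with h | h
    · exact ⟨(e, -1), by simpa using h⟩
    · exact ⟨(e, 1), by simpa using h⟩
  -- A periodic orbit of this successor map on the arcs carrying positive flow is a closed walk.
  let g : α → α := fun a => ⟨next a.1 a.2, hpos a.1 a.2⟩
  obtain ⟨x, hx⟩ := exists_mem_periodicPts g
  refine ⟨(Function.periodicOrbit g x).map Subtype.val, ⟨?_, ?_, ?_⟩, ?_⟩
  · rw [Ne, Cycle.map_eq_nil, Function.periodicOrbit_eq_nil_iff_not_periodic_pt, not_not]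
    exact hx
  -- Orbit points are distinct, and positivity excludes opposite orientations of one edge, so edges
  -- do not repeat.
  · have hinj : Function.Injective fun a : α => a.1.1 := fun a b hab => Subtype.ext
      (injOn_fst_of_coordForm_pos (C := {a | 0 < coordForm a f}) (fun _ h => h) a.2 b.2 hab)
    have := Function.nodup_periodicOrbit (f := g) (x := x)
    revert this
    induction Function.periodicOrbit g x using Quotient.inductionOn' with
    | h l =>
      intro h
      change ((l.map Subtype.val).map Prod.fst).Nodup
      rw [List.map_map]
      exact List.Nodup.map hinj h
  · rw [Cycle.chain_map, Function.periodicOrbit_chain' _ hx]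
    intro n
    rw [Function.iterate_succ_apply']
    exact hadj _ _
  · intro a ha
    have ha' : a ∈ (Function.periodicOrbit g x).map Subtype.val := ha
    obtain ⟨b, -, rfl⟩ := Cycle.mem_map.mp ha'
    exact b.2

/-- A vector orthogonal to all coboundaries satisfies conservation of flow. -/
theorem exists_pos_tail_eq_head [Fintype E] {f : E → ℝ}
    (hf : ∀ p : V → ℝ, f ⬝ᵥ G.coboundary p = 0) {a : EdgeOrientation E}
    (ha : 0 < coordForm a f) : ∃ b, 0 < coordForm b f ∧ G.head a = G.tail b := by
  classical
  have hsum := G.sum_tail_mul_coordForm (Pi.single (G.head a) 1) f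
  rw [dotProduct_comm, hf, neg_zero] at hsum
  -- The outflow at the head of `a` is zero and `a.rev` contributes a nonzero term, so some term is
  -- positive.
  obtain ⟨b, -, hb⟩ := Finset.exists_pos_of_sum_zero_of_exists_nonzero _ hsum
    ⟨a.rev, Finset.mem_univ _, by simp [ha.ne']⟩
  by_cases h : G.tail b = G.head a
  · exact ⟨b, by simpa [h] using hb, h.symm⟩
  · simp [h] at hb

theorem isCircuitSystem_cycles [Fintype V] [Nonempty V] [Fintype E] (G : OrientedGraph V E) :
    IsCircuitSystem (LinearMap.range (G.coboundary ∘ₗ (sumZero V).subtype))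
      (cycleArcs '' {c | G.IsDirectedCycle c}) where
  injOn := by
    rintro _ ⟨c, hc, rfl⟩
    exact IsDirectedCycle.injOn hc
  sum_eq_zero := by
    rintro _ ⟨c, hc, rfl⟩ _ ⟨p, rfl⟩
    simp only [LinearMap.comp_apply, coordForm_coboundary]
    exact IsDirectedCycle.sum_eq_zero hc _
  exists_conformal := by
    intro f hf hW
    have hW' : ∀ p : V → ℝ, f ⬝ᵥ G.coboundary p = 0 := by
      intro p
      -- Subtracting the mean lands in `sumZero V` and leaves the coboundary unchanged.
      set m : ℝ := (∑ v, p v) / Fintype.card V with hm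
      have hmem : (fun v => p v - m) ∈ sumZero V := by
        have : (Fintype.card V : ℝ) ≠ 0 := by simp
        simp [sumZero, hm, mul_div_cancel₀ _ this]
      have h := hW _ ⟨⟨_, hmem⟩, rfl⟩
      convert h using 2
      ext e
      simp [coboundary_apply]
    obtain ⟨c, hc, hpos⟩ := exists_isDirectedCycle_pos hf
      fun a ha => exists_pos_tail_eq_head (G := G) hW' ha
    refine ⟨_, ⟨c, hc, rfl⟩, ?_, hpos⟩
    have hnil := hc.ne_nil
    revert hnil
    induction c using Quotient.inductionOn' with
    | h l =>
      intro hnil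
      cases l with
      | nil => exact absurd rfl hnil
      | cons a l => exact ⟨a, by simp [cycleArcs]⟩

end Cycles

/-! ### Cuts -/

section Cuts

variable (G : OrientedGraph V E)

theorem injOn_cutArcs (U : Set V) : Set.InjOn Prod.fst (G.cutArcs U) := by
  intro a ha b hb hab
  rcases EdgeOrientation.eq_or_eq_rev hab with rfl | rfl
  · rfl
  · have := ha.2
    rw [head_rev] at this
    exact absurd hb.1 this

variable [Fintype E]

open Classical in
/-- The linear form of the vertex `v` whose vanishing is one of the equations of `flowSpace`. -/
noncomputable def vertexForm (v : V) : (E → ℝ) →ₗ[ℝ] ℝ :=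
  ∑ a : EdgeOrientation E with a ∈ G.cutArcs {v}, coordForm a

/-- Summation by parts again. Loops are absent from `vertexForm`, but their coboundary is zero. -/
theorem sum_mul_vertexForm [Fintype V] (p : V → ℝ) (y : E → ℝ) :
    ∑ v, p v * G.vertexForm v y = -(G.coboundary p ⬝ᵥ y) := by
  classical
  have h1 : ∀ v, p v * G.vertexForm v y =
      ∑ a, if G.tail a = v then (if G.head a = G.tail a then 0 else
        p (G.tail a) * coordForm a y) else 0 := by
    intro v
    rw [vertexForm, LinearMap.sum_apply, Finset.mul_sum, Finset.sum_filter]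
    refine Finset.sum_congr rfl fun a _ => ?_
    by_cases h : G.tail a = v
    · subst h
      by_cases h' : G.head a = G.tail a <;> simp [cutArcs, h']
    · simp [cutArcs, h]
  simp only [h1]
  rw [Finset.sum_comm]
  simp only [Finset.sum_ite_eq, Finset.mem_univ, if_true]
  rw [sum_edgeOrientation, dotProduct, ← Finset.sum_neg_distrib]
  refine Finset.sum_congr rfl fun e _ => ?_
  rw [tail_neg_one, head_neg_one, coordForm_one, coordForm_neg_one, coboundary_apply]
  by_cases h : G.head (e, 1) = G.tail (e, 1)
  · simp [h]
  · rw [if_neg h, if_neg (Ne.symm h)]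
    ring

variable {G}

theorem coboundary_dotProduct_eq_zero [Fintype V] {y : E → ℝ} (hy : y ∈ G.flowSpace)
    (p : V → ℝ) : G.coboundary p ⬝ᵥ y = 0 := by
  have h := G.sum_mul_vertexForm p y
  have h0 : ∀ v, G.vertexForm v y = 0 := fun v => (Submodule.mem_iInf _).mp hy v
  simp only [h0, mul_zero, Finset.sum_const_zero] at h
  linarith

open Classical in
theorem sum_cutArcs_eq_zero [Fintype V] {y : E → ℝ} (hy : y ∈ G.flowSpace) (U : Set V) :
    ∑ a with a ∈ G.cutArcs U, coordForm a y = 0 := by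
  -- The coboundary of minus the indicator of `U` is `1` on arcs leaving `U` and `-1` on arcs
  -- entering it.
  have h := coboundary_dotProduct_eq_zero hy fun v => if v ∈ U then -1 else 0
  rw [← h, Finset.sum_filter, sum_edgeOrientation, dotProduct]
  refine Finset.sum_congr rfl fun e _ => ?_
  by_cases h1 : G.head (e, 1) ∈ U <;> by_cases h2 : G.tail (e, 1) ∈ U <;>
    simp [cutArcs, tail_neg_one, head_neg_one, coboundary_apply, h1, h2]

/-- Every vector orthogonal to `flowSpace` is a coboundary. -/
theorem exists_eq_coboundary [Fintype V] {f : E → ℝ} (hf : ∀ y ∈ G.flowSpace, f ⬝ᵥ y = 0) :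
    ∃ p, f = G.coboundary p := by
  classical
  have hmem : dotProductBilin ℝ ℝ f ∈ Submodule.span ℝ (Set.range G.vertexForm) := by
    -- A functional vanishing on the common kernel of finitely many forms lies in their span; the
    -- coefficients form, up to sign, the potential.
    refine mem_span_of_iInf_ker_le_ker fun y hy => ?_
    exact hf y hy
  obtain ⟨p, hp⟩ := (Submodule.mem_span_range_iff_exists_fun ℝ).mp hmem
  refine ⟨-p, funext fun e => ?_⟩
  have h := LinearMap.congr_fun hp (Pi.single e 1)
  rw [LinearMap.sum_apply] at h
  simp only [LinearMap.smul_apply, smul_eq_mul] at h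
  rw [sum_mul_vertexForm] at h
  simpa using h.symm

theorem isCircuitSystem_cuts [Fintype V] (G : OrientedGraph V E) :
    IsCircuitSystem G.flowSpace (G.cutArcs '' {U | IsDirectedCut U}) where
  injOn := by
    rintro _ ⟨U, -, rfl⟩
    exact G.injOn_cutArcs U
  sum_eq_zero := by
    rintro _ ⟨U, -, rfl⟩ y hy
    exact sum_cutArcs_eq_zero hy U
  exists_conformal := by
    intro f hf hW
    obtain ⟨p, rfl⟩ := exists_eq_coboundary hW
    obtain ⟨a, ha⟩ : ∃ a, 0 < coordForm a (G.coboundary p) := by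
      obtain ⟨e, he⟩ := Function.ne_iff.mp hf
      rcases lt_or_gt_of_ne he with h | h
      · exact ⟨(e, -1), by simpa using h⟩
      · exact ⟨(e, 1), by simpa using h⟩
    rw [coordForm_coboundary, sub_pos] at ha
    -- Every arc leaving a sublevel set of `p` goes strictly up, so the cut is conformal to the
    -- coboundary.
    have hmem : a ∈ G.cutArcs {v | p v ≤ p (G.tail a)} :=
      ⟨le_refl (p (G.tail a)), not_le.mpr ha⟩
    refine ⟨_, ⟨_, ⟨⟨_, hmem.1⟩, ⟨_, hmem.2⟩⟩, rfl⟩, ⟨a, hmem⟩, fun b hb => ?_⟩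
    rw [coordForm_coboundary, sub_pos]
    exact lt_of_le_of_lt hb.1 (not_le.mp hb.2)

end Cuts

end OrientedGraph

theorem mainTheorem5 {V E : Type*} [Fintype V] [Fintype E] [LinearOrder E]
    (G : OrientedGraph V E) (hG : G.Connected) :
    Set.BijOn (G.bigraphicalOrientation OrientedGraph.expParam)
      (OrientedGraph.regions (G.bigraphicalArrangement OrientedGraph.expParam))
      {O | OrientedGraph.IsPartialOrientation O ∧ G.CycleNeutral O} ∧
    Set.BijOn (G.bicographicalOrientation OrientedGraph.expParam)
      (OrientedGraph.regions (G.bicographicalArrangement OrientedGraph.expParam))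
      {O | OrientedGraph.IsPartialOrientation O ∧ G.CutNeutral O} := by
  have : Nonempty V := hG.nonempty
  constructor
  · have h := OrientedGraph.bijOn_sideOrientation (ℓ := G.potentialDiff)
      (L := G.coboundary ∘ₗ (OrientedGraph.sumZero V).subtype)
      (𝒜 := G.bigraphicalArrangement OrientedGraph.expParam)
      (LinearMap.continuous_of_finiteDimensional _)
      (fun a x => (G.coordForm_coboundary a x.1).symm) ?_ G.isCircuitSystem_cycles
    · simp only [OrientedGraph.MinNeutral, Set.forall_mem_image] at h
      exact h
    · intro x
      refine ⟨fun hx a ha => ?_, ?_⟩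
      -- Loops define no hyperplane, but their difference is zero and never equals a positive
      -- parameter.
      · by_cases hl : G.IsLoop a.1
        · have h0 : G.potentialDiff a x = 0 := by
            obtain ⟨e, δ⟩ := a
            have hl' : (G.ref e).1 = (G.ref e).2 := hl
            rcases Int.units_eq_one_or δ with rfl | rfl <;>
              simp [OrientedGraph.potentialDiff, OrientedGraph.head, OrientedGraph.tail,
                OrientedGraph.arc, hl']
          exact (OrientedGraph.expParam_pos a).ne (h0.symm.trans ha)
        · exact hx ⟨_, ⟨a, hl, rfl⟩, ha⟩
      · rintro h ⟨_, ⟨a, -, rfl⟩, ha⟩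
        exact h a ha
  · have h := OrientedGraph.bijOn_sideOrientation (ℓ := G.flowCoord) (L := G.flowSpace.subtype)
      (𝒜 := G.bicographicalArrangement OrientedGraph.expParam) continuous_subtype_val
      (fun _ _ => rfl) ?_ (𝒞 := G.cutArcs '' {U | OrientedGraph.IsDirectedCut U})
      (by rw [Submodule.range_subtype]; exact G.isCircuitSystem_cuts)
    · simp only [OrientedGraph.MinNeutral, Set.forall_mem_image] at h
      exact h
    · intro x
      refine ⟨fun hx a ha => hx ⟨_, ⟨a, rfl⟩, ha⟩, ?_⟩
      rintro h ⟨_, ⟨a, rfl⟩, ha⟩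
      exact h a ha
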